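/- For an integer $n\ge 0$ let $L_n(x)=\sum_{k=0}^n\binom nk\frac{(-1)^k}{k!}x^k$ be the Laguerre polynomial, and for real $p\ge n$ let $$A(p)=A_n(p)=\frac{\Gamma(1+p)}{n!\,\Gamma(1+p-n)^2}\int_0^\infty \frac{e^{-r}r^{p-n}}{L_n(-r)}\,dr ,$$ where the integral converges. Then: 1. For every $n\ge 0$, $A(p)\to 1$ as $p\to\infty$ ($p$ real). 2. If $1\le n\le 4$, then $A(p)<1$ for all real $p\ge n$; if $n=0$, then $A(p)=1$ for all real $p\ge 0$. 3. Let $0\le n\le 4$ and $\alpha>0$, and put $d\mu_\alpha(z)=\frac{\alpha}{\pi}e^{-\alpha|z|^2}\,dA(z)$ on $\mathbb C$, where $dA$ is Lebesgue measure, and $d\mu_{n,\alpha}(z)=\frac{1}{n!\,\alpha^n L_n(-\alpha|z|^2)}\,d\mu_\alpha(z)$. If $f$ is an entire function with $\|f\|^2:=\int_{\mathbb C}|f|^2\,d\mu_\alpha<\infty$, then $f^{(n)}\in L^2(\mathbb C,\mu_{n,\alpha})$ and $$\int_{\mathbb C}|f^{(n)}|^2\,d\mu_{n,\alpha}\le\|f\|^2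 .$$ -/

import Mathlib

open MeasureTheory

noncomputable section

/-- The Laguerre polynomial `L_n(x) = ∑_{k=0}^n (n choose k) (-1)^k / k! * x^k`, as a real
function. -/
def laguerre (n : ℕ) (x : ℝ) : ℝ :=
  ∑ k ∈ Finset.range (n + 1), (n.choose k : ℝ) * ((-1) ^ k / (k.factorial : ℝ)) * x ^ k

/-- The integrand `e^{-r} r^{p-n} / L_n(-r)`. -/
def laguerreIntegrand (n : ℕ) (p r : ℝ) : ℝ :=
  Real.exp (-r) * r ^ (p - (n : ℝ)) / laguerre n (-r)

/-- `A(p) = Γ(1+p) / (n! Γ(1+p-n)^2) * ∫_0^∞ e^{-r} r^{p-n} / L_n(-r) dr`. -/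
def laguerreA (n : ℕ) (p : ℝ) : ℝ :=
  Real.Gamma (1 + p) / ((n.factorial : ℝ) * Real.Gamma (1 + p - (n : ℝ)) ^ 2) *
    ∫ r in Set.Ioi (0 : ℝ), laguerreIntegrand n p r

/-- The Gaussian measure `dμ_α = (α/π) e^{-α|z|²} dA` on the complex plane. -/
def fockMeasure (α : ℝ) : Measure ℂ :=
  (volume : Measure ℂ).withDensity fun z =>
    ENNReal.ofReal (α / Real.pi * Real.exp (-α * ‖z‖ ^ 2))

/-- The measure `dμ_{n,α} = 1 / (n! α^n L_n(-α|z|²)) dμ_α`. -/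
def fockMeasureN (n : ℕ) (α : ℝ) : Measure ℂ :=
  (fockMeasure α).withDensity fun z =>
    ENNReal.ofReal (1 / ((n.factorial : ℝ) * α ^ n * laguerre n (-α * ‖z‖ ^ 2)))

/-- Membership in the Fock space `F²_α`: entire functions in `L²(ℂ, μ_α)`. -/
def MemFock (α : ℝ) (f : ℂ → ℂ) : Prop :=
  Differentiable ℂ f ∧ MemLp f 2 (fockMeasure α)

end

/-! Write `L` for `L_n(-r)`, a polynomial with `L ≥ 1` on `[0, ∞)`, and `q = p - n`.

Bound `A < 1`: integrating by parts `n` times (`Gamma_mul_gammaMoment`) turns `A(p)` into `(n!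
Γ(q+1))⁻¹ ∫ e^{-r} r^q · r^n (1-D)^n(1/L) dr`. So `A(p) < 1` once `r^n (1-D)^n(1/L) < n!` for `r >
0`. After clearing `L^{n+1}`, this is a polynomial inequality, and for `1 ≤ n ≤ 4` the difference of
the two sides has positive coefficients.

Limit: `n! L = r^n (1 + S)` with `S` a nonnegative combination of negative powers of `r`. Then `1 -
S ≤ 1/(1+S) ≤ 1` traps `A` between Gamma quotients that tend to 1.

Norm inequality: Parseval on circles and polar coordinates make both norms diagonal in the Taylor
coefficients. The ratio of the weights at `a_{k+n}` is exactly `A(k+n) ≤ 1`, and the coefficients of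
index below `n` only help the right-hand side. -/

/-! ### Positivity of `L_n(-r)` and integrability -/

open Polynomial in
/-- The polynomial `L_n(-X)`. -/
noncomputable def laguerreNegPoly (n : ℕ) : Polynomial ℝ :=
  ∑ k ∈ Finset.range (n + 1), C ((n.choose k : ℝ) / (k.factorial : ℝ)) * X ^ k

theorem eval_laguerreNegPoly (n : ℕ) (r : ℝ) :
    (laguerreNegPoly n).eval r = laguerre n (-r) := by
  rw [laguerreNegPoly, laguerre, Polynomial.eval_finsetSum]
  refine Finset.sum_congr rfl fun k _ => ?_
  have h : (-r) ^ k = (-1) ^ k * r ^ k := by rw [← mul_pow, neg_one_mul]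
  have h1 : ((-1 : ℝ) ^ k) * (-1) ^ k = 1 := by rw [← mul_pow]; simp
  simp only [Polynomial.eval_mul, Polynomial.eval_C, Polynomial.eval_pow, Polynomial.eval_X]
  rw [h]
  linear_combination -((n.choose k : ℝ) / (k.factorial : ℝ) * r ^ k) * h1

theorem one_le_laguerre_neg (n : ℕ) {r : ℝ} (hr : 0 ≤ r) : 1 ≤ laguerre n (-r) := by
  rw [← eval_laguerreNegPoly, laguerreNegPoly, Polynomial.eval_finsetSum]
  simp only [Polynomial.eval_mul, Polynomial.eval_C, Polynomial.eval_pow, Polynomial.eval_X]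
  have := Finset.single_le_sum (f := fun k => (n.choose k : ℝ) / (k.factorial : ℝ) * r ^ k)
    (fun k _ => by positivity) (Finset.mem_range.2 (Nat.succ_pos n))
  simpa using this

theorem integrableOn_exp_neg_mul_rpow_mul_polynomial (P : Polynomial ℝ) {s : ℝ} (hs : -1 < s) :
    IntegrableOn (fun r => Real.exp (-r) * r ^ s * P.eval r) (Set.Ioi 0) := by
  induction P using Polynomial.induction_on' with
  | add p q hp hq =>
    refine (hp.add hq).congr_fun (fun r _ => ?_) measurableSet_Ioi
    simp [mul_add]
  | monomial k a =>
    have hk : (0 : ℝ) ≤ k := k.cast_nonneg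
    have h : IntegrableOn (fun r => a * (Real.exp (-r) * r ^ (s + k + 1 - 1))) (Set.Ioi 0) :=
      (Real.GammaIntegral_convergent (s := s + k + 1) (by linarith)).const_mul a
    refine h.congr_fun (fun r hr => ?_) measurableSet_Ioi
    have hr : (0 : ℝ) < r := hr
    simp only [Polynomial.eval_monomial, add_sub_cancel_right]
    rw [Real.rpow_add_natCast hr.ne']
    ring

/-! ### Gamma-type moments and integration by parts -/

/-- The integral of a rational function `P / L ^ m` against `e^{-r} r^s`. -/
noncomputable def gammaMoment (L : Polynomial ℝ) (s : ℝ) (P : Polynomial ℝ) (m : ℕ) : ℝ :=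
  ∫ r in Set.Ioi (0 : ℝ), Real.exp (-r) * r ^ s * (P.eval r / L.eval r ^ m)

theorem integrableOn_gammaMoment {L : Polynomial ℝ} (hL : ∀ r, 0 ≤ r → 1 ≤ L.eval r)
    (P : Polynomial ℝ) (m : ℕ) {s : ℝ} (hs : -1 < s) :
    IntegrableOn (fun r => Real.exp (-r) * r ^ s * (P.eval r / L.eval r ^ m)) (Set.Ioi 0) := by
  refine (integrableOn_exp_neg_mul_rpow_mul_polynomial P hs).norm.mono' ?_ ?_
  · have h1 := P.continuous.measurable
    have h2 := L.continuous.measurable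
    exact Measurable.aestronglyMeasurable (by fun_prop)
  · refine (ae_restrict_iff' measurableSet_Ioi).2 (Filter.Eventually.of_forall fun r hr => ?_)
    rw [norm_mul, norm_mul _ (P.eval r), norm_div]
    refine mul_le_mul_of_nonneg_left (div_le_self (norm_nonneg _) ?_) (norm_nonneg _)
    have := hL r (le_of_lt hr)
    exact (one_le_pow₀ this).trans (le_abs_self _)

/-- Integration by parts for `e^{-r} r^s` against `P / L ^ m`. -/
theorem mul_gammaMoment_sub_one {L : Polynomial ℝ} (hL : ∀ r, 0 ≤ r → 1 ≤ L.eval r)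
    (P : Polynomial ℝ) (m : ℕ) {s : ℝ} (hs : 0 < s) :
    s * gammaMoment L (s - 1) P m =
      gammaMoment L s ((P - P.derivative) * L + m * P * L.derivative) (m + 1) := by
  set Q := (P - P.derivative) * L + m * P * L.derivative with hQ
  have i1 := (integrableOn_gammaMoment hL P m (s := s - 1) (by linarith)).const_mul s
  have i2 := integrableOn_gammaMoment hL Q (m + 1) (s := s) (by linarith)
  have hderiv : ∀ r ∈ Set.Ioi (0 : ℝ),
      HasDerivAt (fun r => Real.exp (-r) * r ^ s * (P.eval r / L.eval r ^ m))
        (s * (Real.exp (-r) * r ^ (s - 1) * (P.eval r / L.eval r ^ m)) -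
          Real.exp (-r) * r ^ s * (Q.eval r / L.eval r ^ (m + 1))) r := by
    intro r hr
    have hr : (0 : ℝ) < r := hr
    have hp : 0 < L.eval r := lt_of_lt_of_le one_pos (hL r hr.le)
    have d1 : HasDerivAt (fun r : ℝ => Real.exp (-r)) (-Real.exp (-r)) r := by
      simpa using (hasDerivAt_neg r).exp
    have d2 : HasDerivAt (fun r : ℝ => r ^ s) (s * r ^ (s - 1)) r :=
      Real.hasDerivAt_rpow_const (Or.inl hr.ne')
    have d3 := (P.hasDerivAt r).div ((L.hasDerivAt r).pow m) (pow_ne_zero m hp.ne')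
    refine ((d1.mul d2).mul d3).congr_deriv ?_
    simp only [hQ, Polynomial.eval_add, Polynomial.eval_mul, Polynomial.eval_sub,
      Polynomial.eval_natCast, Pi.mul_apply, Pi.pow_apply, Pi.div_apply]
    -- The derivative of `L ^ m` carries the truncated exponent `m - 1`, so `m = 0` is separate.
    rcases m with _ | m
    · simp; field_simp; ring
    · simp only [Nat.add_sub_cancel]
      field_simp
      ring
  have hcont : ContinuousWithinAt
      (fun r => Real.exp (-r) * r ^ s * (P.eval r / L.eval r ^ m)) (Set.Ici 0) 0 := by
    have h0 : L.eval 0 ^ m ≠ 0 := by have := hL 0 le_rfl; positivity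
    refine ContinuousAt.continuousWithinAt ?_
    refine ContinuousAt.mul (ContinuousAt.mul (by fun_prop) ?_) ?_
    · exact Real.continuousAt_rpow_const _ _ (Or.inr hs.le)
    · exact P.continuous.continuousAt.div (L.continuous.continuousAt.pow m) h0
  -- The boundary term at 0 vanishes because `s > 0`; the one at infinity because both the function
  -- and its derivative are integrable.
  have key := integral_Ioi_of_hasDerivAt_of_tendsto hcont hderiv (i1.sub i2)
    (tendsto_zero_of_hasDerivAt_of_integrableOn_Ioi hderiv (i1.sub i2)
      (integrableOn_gammaMoment hL P m (by linarith)))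
  rw [integral_sub i1 i2, integral_const_mul] at key
  simp only [Real.zero_rpow hs.ne', mul_zero, zero_mul, sub_zero] at key
  exact sub_eq_zero.1 key

open Polynomial in
/-- Numerators of `(1 - D) ^ k (1 / L)` over the denominator `L ^ (k + 1)`. -/
noncomputable def oneSubDerivNumerator (L : Polynomial ℝ) : ℕ → Polynomial ℝ
  | 0 => 1
  | k + 1 => (oneSubDerivNumerator L k - derivative (oneSubDerivNumerator L k)) * L +
      ((k + 1 : ℕ) : Polynomial ℝ) * oneSubDerivNumerator L k * derivative L

/-- Each integration by parts raises the exponent of `r` by one and applies `1 - D` to the rational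
factor; the constants produced build up the Gamma quotient. -/
theorem Gamma_mul_gammaMoment {L : Polynomial ℝ} (hL : ∀ r, 0 ≤ r → 1 ≤ L.eval r)
    (k : ℕ) {q : ℝ} (hq : 0 ≤ q) :
    Real.Gamma (q + 1 + k) * gammaMoment L q 1 1 =
      Real.Gamma (q + 1) * gammaMoment L (q + k) (oneSubDerivNumerator L k) (k + 1) := by
  induction k with
  | zero => simp [oneSubDerivNumerator]
  | succ k ih =>
    have hk : (0 : ℝ) ≤ k := k.cast_nonneg
    have h := mul_gammaMoment_sub_one hL (oneSubDerivNumerator L k) (k + 1) (s := q + k + 1)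
      (by linarith)
    rw [show q + k + 1 - 1 = q + k by ring] at h
    rw [show q + 1 + ((k + 1 : ℕ) : ℝ) = (q + 1 + k) + 1 by push_cast; ring,
      Real.Gamma_add_one (by linarith), show q + ((k + 1 : ℕ) : ℝ) = q + k + 1 by push_cast; ring,
      mul_assoc, ih, oneSubDerivNumerator, ← h]
    ring

theorem laguerreIntegrand_eq (n : ℕ) (p r : ℝ) :
    laguerreIntegrand n p r = Real.exp (-r) * r ^ (p - n) *
      ((1 : Polynomial ℝ).eval r / (laguerreNegPoly n).eval r ^ 1) := by
  simp [laguerreIntegrand, eval_laguerreNegPoly, div_eq_mul_inv]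

theorem one_le_eval_laguerreNegPoly (n : ℕ) (r : ℝ) (hr : 0 ≤ r) :
    1 ≤ (laguerreNegPoly n).eval r :=
  (one_le_laguerre_neg n hr).trans_eq (eval_laguerreNegPoly n r).symm

theorem integrableOn_laguerreIntegrand (n : ℕ) {p : ℝ} (hp : n ≤ p) :
    IntegrableOn (laguerreIntegrand n p) (Set.Ioi 0) := by
  rw [funext (laguerreIntegrand_eq n p)]
  exact integrableOn_gammaMoment (one_le_eval_laguerreNegPoly n) 1 1 (by linarith)

theorem integral_laguerreIntegrand (n : ℕ) (p : ℝ) :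
    ∫ r in Set.Ioi (0 : ℝ), laguerreIntegrand n p r =
      gammaMoment (laguerreNegPoly n) (p - n) 1 1 := by
  rw [funext (laguerreIntegrand_eq n p), gammaMoment]

/-- Puts `Γ(q+1)` over the denominator `L ^ m`, for comparison with other moments under one
integral. -/
theorem gammaMoment_self_pow {L : Polynomial ℝ} (hL : ∀ r, 0 ≤ r → 1 ≤ L.eval r) {q : ℝ}
    (hq : -1 < q) (m : ℕ) : gammaMoment L q (L ^ m) m = Real.Gamma (q + 1) := by
  rw [gammaMoment, Real.Gamma_eq_integral (by linarith)]
  refine setIntegral_congr_fun measurableSet_Ioi fun r hr => ?_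
  have := hL r (le_of_lt hr)
  have h0 : L.eval r ^ m ≠ 0 := by positivity
  simp [h0]

/-! ### The bound `A < 1` and the case `n = 0` -/

open Polynomial in
theorem laguerreA_lt_one_of_eval_pos {n : ℕ} {p : ℝ} (hp : n ≤ p)
    (h : ∀ r : ℝ, 0 < r → r ^ n *
        (oneSubDerivNumerator (laguerreNegPoly n) n).eval r <
      n.factorial * (laguerreNegPoly n).eval r ^ (n + 1)) : laguerreA n p < 1 := by
  have hL := one_le_eval_laguerreNegPoly n
  obtain ⟨q, rfl⟩ : ∃ q, p = q + n := ⟨p - n, by ring⟩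
  have hq : 0 ≤ q := by linarith
  have hG : 0 < Real.Gamma (q + 1) := Real.Gamma_pos_of_pos (by linarith)
  have key := Gamma_mul_gammaMoment hL n hq
  have hlt : gammaMoment (laguerreNegPoly n) (q + n)
      (oneSubDerivNumerator (laguerreNegPoly n) n) (n + 1) < n.factorial * Real.Gamma (q + 1) := by
    rw [← gammaMoment_self_pow hL (by linarith) (n + 1), gammaMoment, gammaMoment,
      ← integral_const_mul, ← sub_pos]
    have i1 := integrableOn_gammaMoment hL (oneSubDerivNumerator (laguerreNegPoly n) n) (n + 1)
      (s := q + n) (by linarith [(n.cast_nonneg : (0 : ℝ) ≤ n)])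
    have i2 := (integrableOn_gammaMoment hL (laguerreNegPoly n ^ (n + 1)) (n + 1)
      (s := q) (by linarith)).const_mul (n.factorial : ℝ)
    rw [← integral_sub i2 i1]
    have hpos : ∀ r ∈ Set.Ioi (0 : ℝ), 0 < (n.factorial : ℝ) * (Real.exp (-r) * r ^ q *
        ((laguerreNegPoly n ^ (n + 1)).eval r / (laguerreNegPoly n).eval r ^ (n + 1))) -
        Real.exp (-r) * r ^ (q + n) * ((oneSubDerivNumerator (laguerreNegPoly n) n).eval r /
          (laguerreNegPoly n).eval r ^ (n + 1)) := by
      intro r hr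
      have hr : (0 : ℝ) < r := hr
      have hp : 0 < (laguerreNegPoly n).eval r := one_pos.trans_le (hL r hr.le)
      have : 0 < Real.exp (-r) * r ^ q / (laguerreNegPoly n).eval r ^ (n + 1) := by positivity
      have := mul_pos this (sub_pos.2 (h r hr))
      refine this.trans_eq ?_
      rw [Real.rpow_add_natCast hr.ne', eval_pow]
      ring
    -- Strictness survives integration: the integrand is positive on all of `(0, ∞)`.
    rw [setIntegral_pos_iff_support_of_nonneg_ae]
    · have hvol : 0 < volume (Set.Ioi (0 : ℝ)) := by simp
      exact hvol.trans_le (measure_mono fun r hr => ⟨(hpos r hr).ne', hr⟩)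
    · exact (ae_restrict_iff' measurableSet_Ioi).2
        (Filter.Eventually.of_forall fun r hr => (hpos r hr).le)
    · exact i2.sub i1
  rw [laguerreA, integral_laguerreIntegrand, add_sub_cancel_right,
    show 1 + (q + n) - n = q + 1 by ring, show 1 + (q + n) = q + 1 + n by ring, div_mul_eq_mul_div,
    key, div_lt_one (by positivity)]
  nlinarith

theorem laguerreA_lt_one {n : ℕ} (h1 : 1 ≤ n) (h4 : n ≤ 4) {p : ℝ} (hp : n ≤ p) :
    laguerreA n p < 1 := by
  refine laguerreA_lt_one_of_eval_pos hp fun r hr => ?_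
  interval_cases n <;>
  -- The expanded difference has only positive coefficients, which is what `positivity` needs.
  · simp [oneSubDerivNumerator, laguerreNegPoly, Finset.sum_range_succ, Nat.choose, Nat.factorial]
    rw [← sub_pos]
    ring_nf
    positivity

theorem laguerreA_zero {p : ℝ} (hp : 0 ≤ p) : laguerreA 0 p = 1 := by
  have h : gammaMoment (laguerreNegPoly 0) p 1 1 = Real.Gamma (p + 1) := by
    rw [← gammaMoment_self_pow (one_le_eval_laguerreNegPoly 0) (by linarith) 1]
    simp [laguerreNegPoly]
  have hG : 0 < Real.Gamma (p + 1) := Real.Gamma_pos_of_pos (by linarith)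
  rw [laguerreA, integral_laguerreIntegrand]
  simp only [Nat.cast_zero, sub_zero, h, add_comm 1 p, Nat.factorial_zero, Nat.cast_one]
  field_simp

/-! ### The limit of `A` at infinity -/

open Filter Topology in
theorem tendsto_Gamma_add_nat_div (j : ℕ) :
    Tendsto (fun x : ℝ => Real.Gamma (x + j) / (Real.Gamma x * x ^ j)) atTop (𝓝 1) := by
  induction j with
  | zero =>
    refine tendsto_const_nhds.congr' ?_
    filter_upwards [eventually_gt_atTop 0] with x hx
    have := Real.Gamma_pos_of_pos hx
    simp [this.ne']
  | succ j ih =>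
    have h : Tendsto (fun x : ℝ => 1 + j * x⁻¹) atTop (𝓝 (1 + j * 0)) :=
      (tendsto_inv_atTop_zero.const_mul _).const_add _
    have h2 := h.mul ih
    simp only [mul_zero, add_zero, mul_one] at h2
    refine h2.congr' ?_
    filter_upwards [eventually_gt_atTop 0] with x hx
    have := Real.Gamma_pos_of_pos hx
    have hj : (0 : ℝ) ≤ j := j.cast_nonneg
    rw [show x + ((j + 1 : ℕ) : ℝ) = x + j + 1 by push_cast; ring,
      Real.Gamma_add_one (by linarith)]
    field_simp
    ring

open Filter Topology in
theorem tendsto_Gamma_sub_nat_div {j : ℕ} (hj : j ≠ 0) :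
    Tendsto (fun x : ℝ => Real.Gamma (x - j) / Real.Gamma x) atTop (𝓝 0) := by
  have h := ((tendsto_Gamma_add_nat_div j).pos_mul_atTop one_pos
    (tendsto_pow_atTop hj)).inv_tendsto_atTop
  refine (h.comp (tendsto_atTop_add_const_right _ (-(j : ℝ)) tendsto_id)).congr' ?_
  filter_upwards [eventually_gt_atTop (j : ℝ)] with x hx
  have := Real.Gamma_pos_of_pos (sub_pos.2 hx)
  have hx' : 0 < x - j := sub_pos.2 hx
  simp only [Function.comp_apply, Pi.inv_apply, id_eq, ← sub_eq_add_neg, sub_add_cancel]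
  field_simp

open Filter Topology in
theorem tendsto_Gamma_mul_Gamma_div (n : ℕ) :
    Tendsto (fun x : ℝ => Real.Gamma (x + 2 * n) * Real.Gamma x / Real.Gamma (x + n) ^ 2)
      atTop (𝓝 1) := by
  have h := (tendsto_Gamma_add_nat_div (2 * n)).div ((tendsto_Gamma_add_nat_div n).pow 2) (by simp)
  rw [one_pow, div_one] at h
  refine h.congr' ?_
  filter_upwards [eventually_gt_atTop 0] with x hx
  have := Real.Gamma_pos_of_pos hx
  have hn : (0 : ℝ) ≤ n := n.cast_nonneg
  have := Real.Gamma_pos_of_pos (show 0 < x + n by linarith)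
  simp only [Pi.div_apply]
  push_cast
  field_simp
  ring

theorem integrableOn_exp_neg_mul_rpow {s : ℝ} (hs : 0 < s) :
    IntegrableOn (fun r : ℝ => Real.exp (-r) * r ^ (s - 1)) (Set.Ioi 0) :=
  Real.GammaIntegral_convergent hs

theorem factorial_mul_laguerre_neg (n : ℕ) {r : ℝ} (hr : 0 < r) :
    n.factorial * laguerre n (-r) = r ^ n * (1 + ∑ k ∈ Finset.range n,
      (n.factorial * n.choose k / k.factorial : ℝ) * (r ^ (n - k))⁻¹) := by
  rw [← eval_laguerreNegPoly, laguerreNegPoly, Polynomial.eval_finsetSum, Finset.sum_range_succ,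
    mul_add, mul_add, Finset.mul_sum, Finset.mul_sum, add_comm]
  have hn : (n.factorial : ℝ) ≠ 0 := by positivity
  congr 1
  · simp
    field_simp
  · refine Finset.sum_congr rfl fun k hk => ?_
    have hk : k < n := Finset.mem_range.1 hk
    have : r ^ n = r ^ k * r ^ (n - k) := by rw [← pow_add, Nat.add_sub_cancel' hk.le]
    simp only [Polynomial.eval_mul, Polynomial.eval_C, Polynomial.eval_pow, Polynomial.eval_X]
    rw [this]
    field_simp

/-- The shift `p = x + 2n - 1` makes the leading part of the integrand `n! e^{-r} r^{x-1}`, whose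
integral is `n! Γ(x)`. The bounds are `1 - S ≤ 1/(1+S) ≤ 1`. -/
theorem laguerreIntegrand_bounds (n : ℕ) {x r : ℝ} (hr : 0 < r) :
    laguerreIntegrand n (x + 2 * n - 1) r ≤ n.factorial * (Real.exp (-r) * r ^ (x - 1)) ∧
    n.factorial * (Real.exp (-r) * r ^ (x - 1) - ∑ k ∈ Finset.range n,
      (n.factorial * n.choose k / k.factorial : ℝ) *
        (Real.exp (-r) * r ^ (x - (n - k : ℕ) - 1))) ≤ laguerreIntegrand n (x + 2 * n - 1) r := by
  set c : ℕ → ℝ := fun k => n.factorial * n.choose k / k.factorial with hc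
  set S := ∑ k ∈ Finset.range n, c k * (r ^ (n - k))⁻¹ with hS
  have hS0 : 0 ≤ S := Finset.sum_nonneg fun k _ => by simp only [hc]; positivity
  have hL : laguerre n (-r) = r ^ n * (1 + S) / n.factorial := by
    rw [← factorial_mul_laguerre_neg n hr]; field_simp
  have hI : laguerreIntegrand n (x + 2 * n - 1) r =
      n.factorial * (Real.exp (-r) * r ^ (x - 1)) * (1 + S)⁻¹ := by
    rw [laguerreIntegrand, hL, show x + 2 * n - 1 - n = (x - 1) + (n : ℝ) by ring,
      Real.rpow_add_natCast hr.ne']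
    field_simp
  have hsum : ∑ k ∈ Finset.range n, c k * (Real.exp (-r) * r ^ (x - (n - k : ℕ) - 1)) =
      Real.exp (-r) * r ^ (x - 1) * S := by
    rw [hS, Finset.mul_sum]
    refine Finset.sum_congr rfl fun k _ => ?_
    rw [show x - ((n - k : ℕ) : ℝ) - 1 = (x - 1) - ((n - k : ℕ) : ℝ) by ring,
      Real.rpow_sub_natCast hr.ne']
    ring
  have hpos : 0 ≤ n.factorial * (Real.exp (-r) * r ^ (x - 1)) := by positivity
  rw [hI, hsum]
  constructor
  · exact mul_le_of_le_one_right hpos (inv_le_one_of_one_le₀ (by linarith))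
  · have : 1 - S ≤ (1 + S)⁻¹ := by
      rw [← one_div, le_div_iff₀ (by linarith)]
      nlinarith
    calc _ = n.factorial * (Real.exp (-r) * r ^ (x - 1)) * (1 - S) := by ring
      _ ≤ _ := mul_le_mul_of_nonneg_left this hpos

theorem laguerreA_bounds (n : ℕ) {x : ℝ} (hx : n < x) :
    laguerreA n (x + 2 * n - 1) ≤
      Real.Gamma (x + 2 * n) * Real.Gamma x / Real.Gamma (x + n) ^ 2 ∧
    Real.Gamma (x + 2 * n) * Real.Gamma x / Real.Gamma (x + n) ^ 2 *
      (1 - ∑ k ∈ Finset.range n, (n.factorial * n.choose k / k.factorial : ℝ) *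
        (Real.Gamma (x - (n - k : ℕ)) / Real.Gamma x)) ≤ laguerreA n (x + 2 * n - 1) := by
  have hn : (0 : ℝ) ≤ n := n.cast_nonneg
  have hx0 : 0 < x := by linarith
  have hG := Real.Gamma_pos_of_pos hx0
  have hG1 := Real.Gamma_pos_of_pos (show 0 < x + n by linarith)
  have hG2 := Real.Gamma_pos_of_pos (show 0 < x + 2 * n by linarith)
  have i0 : IntegrableOn (laguerreIntegrand n (x + 2 * n - 1)) (Set.Ioi 0) := by
    -- For `n = 0` the exponent `x - 1` may be negative, but it exceeds `-1`.
    rcases Nat.eq_zero_or_pos n with rfl | h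
    · rw [funext (laguerreIntegrand_eq 0 _)]
      exact integrableOn_gammaMoment (one_le_eval_laguerreNegPoly 0) 1 1 (by simp; simpa using hx0)
    · have : (1 : ℝ) ≤ n := by exact_mod_cast h
      exact integrableOn_laguerreIntegrand n (by linarith)
  have i1 := integrableOn_exp_neg_mul_rpow hx0
  have hkx : ∀ k : ℕ, 0 < x - ((n - k : ℕ) : ℝ) := fun k => by
    have : ((n - k : ℕ) : ℝ) ≤ n := by exact_mod_cast Nat.sub_le n k
    linarith
  have i2 : ∀ k ∈ Finset.range n, IntegrableOn (fun r : ℝ =>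
      (n.factorial * n.choose k / k.factorial : ℝ) *
        (Real.exp (-r) * r ^ (x - (n - k : ℕ) - 1))) (Set.Ioi 0) := fun k _ =>
    Integrable.const_mul (integrableOn_exp_neg_mul_rpow (hkx k)) _
  have u := setIntegral_mono_on i0 (Integrable.const_mul i1 (n.factorial : ℝ)) measurableSet_Ioi
    fun r hr => (laguerreIntegrand_bounds n (x := x) hr).1
  have l := setIntegral_mono_on
    (Integrable.const_mul (Integrable.sub i1 (integrable_finsetSum _ i2)) (n.factorial : ℝ)) i0
    measurableSet_Ioi fun r hr => (laguerreIntegrand_bounds n (x := x) hr).2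
  simp only [Pi.sub_apply, integral_const_mul] at u l
  rw [integral_sub i1 (integrable_finsetSum _ i2), integral_finsetSum _ i2] at l
  simp only [integral_const_mul] at l
  rw [← Real.Gamma_eq_integral hx0] at u l
  simp only [← Real.Gamma_eq_integral (hkx _)] at l
  have hA : laguerreA n (x + 2 * n - 1) = Real.Gamma (x + 2 * n) /
      (n.factorial * Real.Gamma (x + n) ^ 2) *
        ∫ r in Set.Ioi (0 : ℝ), laguerreIntegrand n (x + 2 * n - 1) r := by
    rw [laguerreA, show 1 + (x + 2 * n - 1) = x + 2 * n by ring,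
      show x + 2 * n - n = x + (n : ℝ) by ring]
  have hc : 0 ≤ Real.Gamma (x + 2 * n) / (n.factorial * Real.Gamma (x + n) ^ 2) := by positivity
  rw [hA]
  constructor
  · refine (mul_le_mul_of_nonneg_left u hc).trans_eq ?_
    field_simp
  · refine le_trans (le_of_eq ?_) (mul_le_mul_of_nonneg_left l hc)
    have : ∑ k ∈ Finset.range n, (n.factorial * n.choose k / k.factorial : ℝ) *
        Real.Gamma (x - (n - k : ℕ)) = Real.Gamma x * ∑ k ∈ Finset.range n,
        (n.factorial * n.choose k / k.factorial : ℝ) *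
          (Real.Gamma (x - (n - k : ℕ)) / Real.Gamma x) := by
      rw [Finset.mul_sum]
      refine Finset.sum_congr rfl fun k _ => ?_
      field_simp
    rw [this]
    field_simp

open Filter Topology in
theorem tendsto_laguerreA (n : ℕ) : Tendsto (laguerreA n) atTop (𝓝 1) := by
  have hU := tendsto_Gamma_mul_Gamma_div n
  have hS : Tendsto (fun x : ℝ => ∑ k ∈ Finset.range n,
      (n.factorial * n.choose k / k.factorial : ℝ) *
        (Real.Gamma (x - (n - k : ℕ)) / Real.Gamma x)) atTop (𝓝 (∑ k ∈ Finset.range n,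
      (n.factorial * n.choose k / k.factorial : ℝ) * 0)) :=
    tendsto_finsetSum _ fun k hk => (tendsto_Gamma_sub_nat_div
      (Nat.sub_ne_zero_of_lt (Finset.mem_range.1 hk))).const_mul _
  have hl := hU.mul (hS.const_sub 1)
  simp only [mul_zero, Finset.sum_const_zero, sub_zero, mul_one] at hl
  have h : Tendsto (fun x : ℝ => laguerreA n (x + 2 * n - 1)) atTop (𝓝 1) := by
    refine tendsto_of_tendsto_of_tendsto_of_le_of_le' hl hU ?_ ?_
    · filter_upwards [eventually_gt_atTop (n : ℝ)] with x hx using (laguerreA_bounds n hx).2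
    · filter_upwards [eventually_gt_atTop (n : ℝ)] with x hx using (laguerreA_bounds n hx).1
  refine (h.comp (tendsto_atTop_add_const_right _ (1 - 2 * (n : ℝ)) tendsto_id)).congr fun p => ?_
  simp only [Function.comp_apply, id_eq]
  ring_nf

/-! ### Parseval on circles and radially weighted norms -/

/-- Parseval's identity for a convergent expansion in an orthonormal family. -/
theorem hasSum_norm_sq_of_hasSum_smul_orthonormal {ι E : Type*} [NormedAddCommGroup E]
    [InnerProductSpace ℂ E] {e : ι → E} (he : Orthonormal ℂ e) {c : ι → ℂ} {x : E}
    (h : HasSum (fun i => c i • e i) x) : HasSum (fun i => ‖c i‖ ^ 2) (‖x‖ ^ 2) := by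
  classical
  have h1 : ∀ i, inner ℂ (e i) x = c i := fun i => by
    have h2 := h.mapL (innerSL ℂ (e i))
    have h3 : ∀ j, j ≠ i → innerSL ℂ (e i) (c j • e j) = 0 := fun j hj => by
      simp [he.2 hj.symm]
    have h4 := h2.unique (hasSum_single i h3)
    simpa [inner_smul_right, he.1 i, inner_self_eq_norm_sq_to_K] using h4
  have h2 := Complex.hasSum_re (h.mapL (innerSL ℂ x))
  have h3 : ∀ i, (innerSL ℂ x (c i • e i)).re = ‖c i‖ ^ 2 := fun i => by
    rw [innerSL_apply_apply, inner_smul_right, ← inner_conj_symm, h1, Complex.mul_conj,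
      Complex.normSq_eq_norm_sq, Complex.ofReal_re]
  have h4 : (innerSL ℂ x x).re = ‖x‖ ^ 2 := by
    rw [innerSL_apply_apply, inner_self_eq_norm_sq_to_K]
    norm_cast
  simpa only [h3, h4] using h2

open Real in
/-- Parseval's identity on the circle of radius `ρ`. -/
theorem lintegral_circle_enorm_sq {a : ℕ → ℂ} {g : ℂ → ℂ}
    (hg : ∀ z, HasSum (fun k => a k * z ^ k) (g z)) {ρ : ℝ} (hρ : 0 ≤ ρ) :
    ∫⁻ θ in Set.Ioo (-π) π, ‖g (ρ * (Real.cos θ + Real.sin θ * Complex.I))‖ₑ ^ 2 =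
      ENNReal.ofReal (2 * π) * ∑' k, ‖a k‖ₑ ^ 2 * ENNReal.ofReal (ρ ^ (2 * k)) := by
  have hT : Fact (0 < 2 * π) := ⟨by positivity⟩
  let c : ℕ → ℂ := fun k => a k * (ρ : ℂ) ^ k
  have hc : Summable fun k => ‖c k‖ := (hg ρ).summable.norm
  have hF : Summable fun k : ℕ => c k • @fourier (2 * π) (k : ℤ) := by
    refine Summable.of_norm ?_
    simpa [norm_smul, fourier_norm] using hc
  set F : C(AddCircle (2 * π), ℂ) := ∑' k : ℕ, c k • @fourier (2 * π) (k : ℤ) with hFdef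
  have hFθ : ∀ θ : ℝ, F (θ : AddCircle (2 * π)) =
      g (ρ * (Real.cos θ + Real.sin θ * Complex.I)) := fun θ => by
    have h := ContinuousMap.hasSum_apply hF.hasSum (θ : AddCircle (2 * π))
    refine h.unique ?_
    convert! hg (ρ * (Real.cos θ + Real.sin θ * Complex.I)) using 2 with k
    have hpi : (π : ℂ) ≠ 0 := by exact_mod_cast Real.pi_ne_zero
    rw [ContinuousMap.smul_apply, fourier_coe_apply, Complex.ofReal_cos, Complex.ofReal_sin,
      ← Complex.exp_mul_I, mul_pow, ← Complex.exp_nat_mul, smul_eq_mul, mul_assoc]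
    congr 3
    push_cast
    field_simp
  have hLp : HasSum (fun k : ℕ => c k • @fourierLp (2 * π) _ 2 _ (k : ℤ))
      (ContinuousMap.toLp (E := ℂ) 2 AddCircle.haarAddCircle ℂ F) := by
    simpa using hF.hasSum.mapL (ContinuousMap.toLp (E := ℂ) 2 AddCircle.haarAddCircle ℂ)
  have hP := hasSum_norm_sq_of_hasSum_smul_orthonormal
    ((@orthonormal_fourier (2 * π) _).comp _ Nat.cast_injective) hLp
  have hn : ‖ContinuousMap.toLp (E := ℂ) 2 AddCircle.haarAddCircle ℂ F‖ ^ 2 =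
      ∫ t, ‖F t‖ ^ 2 ∂(@AddCircle.haarAddCircle (2 * π) _) := by
    have h := ContinuousMap.inner_toLp (@AddCircle.haarAddCircle (2 * π) _) (𝕜 := ℂ) F F
    rw [inner_self_eq_norm_sq_to_K] at h
    have h2 : ∀ t, F t * (starRingEnd ℂ) (F t) = ((‖F t‖ ^ 2 : ℝ) : ℂ) := fun t => by
      rw [Complex.mul_conj, Complex.normSq_eq_norm_sq]
    simp only [h2] at h
    rw [integral_complex_ofReal] at h
    exact Complex.ofReal_injective (by rw [← h]; push_cast; rfl)
  have hint : Integrable (fun t => ‖F t‖ ^ 2) (@AddCircle.haarAddCircle (2 * π) _) :=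
    (F.continuous.norm.pow 2).integrable_of_hasCompactSupport
      (HasCompactSupport.of_compactSpace _)
  have hl : ∑' k, ‖a k‖ₑ ^ 2 * ENNReal.ofReal (ρ ^ (2 * k)) =
      ∫⁻ t, ‖F t‖ₑ ^ 2 ∂(@AddCircle.haarAddCircle (2 * π) _) := by
    have h1 : ∀ k, ‖a k‖ₑ ^ 2 * ENNReal.ofReal (ρ ^ (2 * k)) = ENNReal.ofReal (‖c k‖ ^ 2) := by
      intro k
      rw [← ofReal_norm, ← ENNReal.ofReal_pow (norm_nonneg _), ← ENNReal.ofReal_mul (by positivity)]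
      simp only [c, norm_mul, norm_pow, Complex.norm_real, Real.norm_eq_abs, abs_of_nonneg hρ]
      ring_nf
    have h2 : ∀ t, ‖F t‖ₑ ^ 2 = ENNReal.ofReal (‖F t‖ ^ 2) := fun t => by
      rw [← ofReal_norm, ← ENNReal.ofReal_pow (norm_nonneg _)]
    simp only [h1, h2]
    rw [← ENNReal.ofReal_tsum_of_nonneg (fun k => by positivity) hP.summable, hP.tsum_eq, hn,
      ofReal_integral_eq_lintegral_ofReal hint (Filter.Eventually.of_forall fun t => by positivity)]
  -- Haar measure on the circle has mass 1, which accounts for the factor `2π`.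
  rw [hl, ← smul_eq_mul, ← lintegral_smul_measure, ← AddCircle.volume_eq_smul_haarAddCircle,
    ← AddCircle.lintegral_preimage (2 * π) (-π), show -π + 2 * π = π by ring]
  simp only [hFθ]
  exact setLIntegral_congr Ioo_ae_eq_Ioc

/-- The substitution `r = α ρ²`, from the radius to the variable of the Laguerre integrals. -/
theorem lintegral_comp_const_mul_sq {α : ℝ} (hα : 0 < α) (u : ℝ → ENNReal) :
    ∫⁻ r in Set.Ioi 0, u r =
      ∫⁻ ρ in Set.Ioi 0, ENNReal.ofReal (2 * α * ρ) * u (α * ρ ^ 2) := by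
  have himg : (fun ρ : ℝ => α * ρ ^ 2) '' Set.Ioi 0 = Set.Ioi 0 := by
    ext r
    constructor
    · rintro ⟨ρ, hρ, rfl⟩
      have : (0 : ℝ) < ρ := hρ
      exact Set.mem_Ioi.2 (by positivity)
    · intro hr
      have hr : 0 < r := hr
      refine ⟨Real.sqrt (r / α), Real.sqrt_pos.2 (by positivity), ?_⟩
      simp only [Real.sq_sqrt (div_pos hr hα).le]
      field_simp
  have h := lintegral_image_eq_lintegral_deriv_mul_of_monotoneOn (s := Set.Ioi (0 : ℝ))
    (f := fun ρ : ℝ => α * ρ ^ 2)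
    (f' := fun ρ => 2 * α * ρ) measurableSet_Ioi (fun x _ => ?_) (fun x hx y _ hxy => ?_) u
  · rwa [himg] at h
  · refine (((hasDerivAt_pow 2 x).const_mul α).congr_deriv ?_).hasDerivWithinAt
    simp; ring
  · have hx : (0 : ℝ) < x := hx
    simp only
    gcongr

open Real in
/-- Squared norms of an entire function in a radially weighted `L²` space, in terms of its Taylor
coefficients. -/
theorem lintegral_enorm_sq_mul_radial {a : ℕ → ℂ} {g : ℂ → ℂ} (hgc : Continuous g)
    (hg : ∀ z, HasSum (fun k => a k * z ^ k) (g z)) {α : ℝ} (hα : 0 < α) {W : ℝ → ENNReal}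
    (hW : Measurable W) :
    ∫⁻ z, ‖g z‖ₑ ^ 2 * W (α * ‖z‖ ^ 2) =
      ∑' k, ‖a k‖ₑ ^ 2 * ∫⁻ r in Set.Ioi 0, ENNReal.ofReal (π / α * (r / α) ^ k) * W r := by
  rw [← Complex.lintegral_comp_polarCoord_symm, polarCoord_target, Measure.volume_eq_prod,
    ← Measure.prod_restrict, lintegral_prod]
  · have hgm : Measurable g := hgc.measurable
    have h1 : ∀ ρ ∈ Set.Ioi (0 : ℝ), ∫⁻ θ in Set.Ioo (-π) π, ENNReal.ofReal ρ •
        (‖g (Complex.polarCoord.symm (ρ, θ))‖ₑ ^ 2 *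
          W (α * ‖Complex.polarCoord.symm (ρ, θ)‖ ^ 2)) =
        ∑' k, ‖a k‖ₑ ^ 2 * (ENNReal.ofReal (2 * α * ρ) *
          (ENNReal.ofReal (π / α * (α * ρ ^ 2 / α) ^ k) * W (α * ρ ^ 2))) := by
      intro ρ hρ
      have hρ : 0 < ρ := hρ
      have h2 : ∀ θ : ℝ, ENNReal.ofReal ρ • (‖g (Complex.polarCoord.symm (ρ, θ))‖ₑ ^ 2 *
          W (α * ‖Complex.polarCoord.symm (ρ, θ)‖ ^ 2)) =
          (ENNReal.ofReal ρ * W (α * ρ ^ 2)) *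
            ‖g (ρ * (Real.cos θ + Real.sin θ * Complex.I))‖ₑ ^ 2 := by
        intro θ
        rw [Complex.norm_polarCoord_symm, Complex.polarCoord_symm_apply, smul_eq_mul, sq_abs]
        ring
      simp only [h2]
      rw [lintegral_const_mul _ (by fun_prop), lintegral_circle_enorm_sq hg hρ.le,
        ← ENNReal.tsum_mul_left, ← ENNReal.tsum_mul_left]
      refine tsum_congr fun k => ?_
      have h3 : ENNReal.ofReal (2 * α * ρ) * ENNReal.ofReal (π / α * (α * ρ ^ 2 / α) ^ k) =
          ENNReal.ofReal ρ * ENNReal.ofReal (2 * π) * ENNReal.ofReal (ρ ^ (2 * k)) := by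
        rw [← ENNReal.ofReal_mul (by positivity), ← ENNReal.ofReal_mul (by positivity),
          ← ENNReal.ofReal_mul (by positivity)]
        congr 1
        rw [mul_div_cancel_left₀ _ hα.ne', pow_mul]
        field_simp
      rw [← mul_assoc (ENNReal.ofReal (2 * α * ρ)), h3]
      ring
    rw [setLIntegral_congr_fun measurableSet_Ioi h1, lintegral_tsum]
    · refine tsum_congr fun k => ?_
      rw [lintegral_const_mul _ (by fun_prop), lintegral_comp_const_mul_sq hα (fun r => _ * W r)]
    · exact fun k => Measurable.aemeasurable (by fun_prop)
  · have : Measurable fun p : ℝ × ℝ => Complex.polarCoord.symm p := by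
      simp only [Complex.polarCoord_symm_apply]
      fun_prop
    have := hgc.measurable
    exact Measurable.aemeasurable (by fun_prop)

/-! ### The two norms in Taylor coefficients, and their comparison -/

open Real in
theorem lintegral_enorm_sq_fockMeasure {a : ℕ → ℂ} {f : ℂ → ℂ} (hf : Continuous f)
    (ha : ∀ z, HasSum (fun k => a k * z ^ k) (f z)) {α : ℝ} (hα : 0 < α) :
    ∫⁻ z, ‖f z‖ₑ ^ 2 ∂fockMeasure α =
      ∑' k, ‖a k‖ₑ ^ 2 * ENNReal.ofReal (k.factorial / α ^ k) := by
  have hfm : Measurable f := hf.measurable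
  rw [fockMeasure, lintegral_withDensity_eq_lintegral_mul _ (by fun_prop) (by fun_prop)]
  have h := lintegral_enorm_sq_mul_radial hf ha hα
    (W := fun r => ENNReal.ofReal (α / π * Real.exp (-r))) (by fun_prop)
  simp only [Pi.mul_apply, mul_comm (ENNReal.ofReal _) (‖f _‖ₑ ^ 2), neg_mul] at h ⊢
  rw [h]
  refine tsum_congr fun k => ?_
  congr 1
  have hk : (0 : ℝ) < k + 1 := by positivity
  have hΓ : (k.factorial : ℝ) / α ^ k =
      ∫ r in Set.Ioi (0 : ℝ), (α ^ k)⁻¹ * (Real.exp (-r) * r ^ ((k : ℝ) + 1 - 1)) := by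
    rw [integral_const_mul, ← Real.Gamma_eq_integral hk, Real.Gamma_nat_eq_factorial]
    ring
  rw [hΓ, ofReal_integral_eq_lintegral_ofReal ((integrableOn_exp_neg_mul_rpow hk).const_mul _)]
  · refine setLIntegral_congr_fun measurableSet_Ioi fun r hr => ?_
    have hr : 0 < r := hr
    rw [← ENNReal.ofReal_mul (by positivity), add_sub_cancel_right, Real.rpow_natCast]
    congr 1
    rw [div_pow]
    field_simp
  · refine (ae_restrict_iff' measurableSet_Ioi).2 (Filter.Eventually.of_forall fun r hr => ?_)
    have hr : 0 < r := hr
    simp only [Pi.zero_apply]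
    positivity

open Real in
theorem lintegral_enorm_sq_fockMeasureN (n : ℕ) {b : ℕ → ℂ} {g : ℂ → ℂ} (hgc : Continuous g)
    (hb : ∀ z, HasSum (fun k => b k * z ^ k) (g z)) {α : ℝ} (hα : 0 < α) :
    ∫⁻ z, ‖g z‖ₑ ^ 2 ∂fockMeasureN n α =
      ∑' k : ℕ, ‖b k‖ₑ ^ 2 * ENNReal.ofReal ((n.factorial * α ^ (k + n))⁻¹ *
        ∫ r in Set.Ioi (0 : ℝ), laguerreIntegrand n (k + n : ℕ) r) := by
  have hgm : Measurable g := hgc.measurable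
  have hLm : Measurable fun x : ℝ => laguerre n x := by
    unfold laguerre
    fun_prop
  rw [fockMeasureN, lintegral_withDensity_eq_lintegral_mul _ (by fun_prop) (by fun_prop),
    fockMeasure, lintegral_withDensity_eq_lintegral_mul _ (by fun_prop) (by fun_prop)]
  have h := lintegral_enorm_sq_mul_radial hgc hb hα
    (W := fun r => ENNReal.ofReal (1 / (n.factorial * α ^ n * laguerre n (-r))) *
      ENNReal.ofReal (α / π * Real.exp (-r))) (by fun_prop)
  have hint : ∀ z : ℂ, ENNReal.ofReal (α / π * Real.exp (-α * ‖z‖ ^ 2)) *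
      (ENNReal.ofReal (1 / (n.factorial * α ^ n * laguerre n (-α * ‖z‖ ^ 2))) * ‖g z‖ₑ ^ 2) =
      ‖g z‖ₑ ^ 2 * (ENNReal.ofReal (1 / (n.factorial * α ^ n * laguerre n (-(α * ‖z‖ ^ 2)))) *
        ENNReal.ofReal (α / π * Real.exp (-(α * ‖z‖ ^ 2)))) := fun z => by
    rw [neg_mul]
    ring
  simp only [Pi.mul_apply, hint]
  rw [h]
  refine tsum_congr fun k => ?_
  congr 1
  have hI := integrableOn_laguerreIntegrand n (p := (k + n : ℕ))
    (by exact_mod_cast Nat.le_add_left n k)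
  rw [← integral_const_mul, ofReal_integral_eq_lintegral_ofReal (hI.const_mul _)]
  · refine setLIntegral_congr_fun measurableSet_Ioi fun r hr => ?_
    have hr : 0 < r := hr
    have hL := one_pos.trans_le (one_le_laguerre_neg n hr.le)
    rw [← ENNReal.ofReal_mul (by positivity), ← ENNReal.ofReal_mul (by positivity),
      laguerreIntegrand, show (((k + n : ℕ) : ℝ) - n) = k by push_cast; ring, Real.rpow_natCast]
    congr 1
    rw [div_pow, pow_add]
    field_simp
  · refine (ae_restrict_iff' measurableSet_Ioi).2 (Filter.Eventually.of_forall fun r hr => ?_)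
    have hr : 0 < r := hr
    have hL := one_pos.trans_le (one_le_laguerre_neg n hr.le)
    simp only [laguerreIntegrand, Pi.zero_apply]
    positivity

/-- The left side equals the right side times `A(k+n)`. -/
theorem factorial_sq_mul_integral_le {n : ℕ} (hn : n ≤ 4) (k : ℕ) {α : ℝ} (hα : 0 < α) :
    ((k + n).factorial / k.factorial : ℝ) ^ 2 * ((n.factorial * α ^ (k + n))⁻¹ *
      ∫ r in Set.Ioi (0 : ℝ), laguerreIntegrand n (k + n : ℕ) r) ≤
    (k + n).factorial / α ^ (k + n) := by
  have hA : laguerreA n (k + n : ℕ) ≤ 1 := by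
    rcases Nat.eq_zero_or_pos n with rfl | h
    · exact (laguerreA_zero (Nat.cast_nonneg _)).le
    · exact (laguerreA_lt_one h hn (by exact_mod_cast Nat.le_add_left n k)).le
  rw [laguerreA, add_comm 1, Real.Gamma_nat_eq_factorial,
    show ((k + n : ℕ) : ℝ) + 1 - n = k + 1 by push_cast; ring, Real.Gamma_nat_eq_factorial] at hA
  have hc : (0 : ℝ) ≤ (k + n).factorial / α ^ (k + n) := by positivity
  refine (le_of_eq ?_).trans (mul_le_of_le_one_right hc hA)
  field_simp

theorem hasSum_taylor_zero {f : ℂ → ℂ} (hf : Differentiable ℂ f) (z : ℂ) :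
    HasSum (fun k => iteratedDeriv k f 0 / k.factorial * z ^ k) (f z) := by
  refine (Complex.hasSum_taylorSeries_of_entire hf 0 z).congr_fun fun k => ?_
  simp only [sub_zero, smul_eq_mul]
  ring

theorem lintegral_enorm_sq_iteratedDeriv_le {n : ℕ} (hn : n ≤ 4) {α : ℝ} (hα : 0 < α) {f : ℂ → ℂ}
    (hf : Differentiable ℂ f) :
    ∫⁻ z, ‖iteratedDeriv n f z‖ₑ ^ 2 ∂fockMeasureN n α ≤ ∫⁻ z, ‖f z‖ₑ ^ 2 ∂fockMeasure α := by
  have hg : Differentiable ℂ (iteratedDeriv n f) :=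
    (hf.contDiff (n := (n + 1 : ℕ))).differentiable_iteratedDeriv n
      (by exact_mod_cast n.lt_succ_self)
  rw [lintegral_enorm_sq_fockMeasureN n hg.continuous (hasSum_taylor_zero hg) hα,
    lintegral_enorm_sq_fockMeasure hf.continuous (hasSum_taylor_zero hf) hα]
  -- Compare index `k` of the derivative with index `k + n` of `f`, then discard the terms of `f`
  -- below `n`.
  refine le_trans (ENNReal.tsum_le_tsum fun k => ?_)
    (ENNReal.tsum_comp_le_tsum_of_injective (add_left_injective n) _)
  have hd : iteratedDeriv k (iteratedDeriv n f) 0 = iteratedDeriv (k + n) f 0 := by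
    simp only [iteratedDeriv_eq_iterate, Function.iterate_add_apply]
  have hb : ‖iteratedDeriv k (iteratedDeriv n f) 0 / k.factorial‖ₑ ^ 2 =
      ‖iteratedDeriv (k + n) f 0 / (k + n).factorial‖ₑ ^ 2 *
        ENNReal.ofReal (((k + n).factorial / k.factorial : ℝ) ^ 2) := by
    rw [hd, ← ofReal_norm, ← ofReal_norm, ← ENNReal.ofReal_pow (norm_nonneg _),
      ← ENNReal.ofReal_pow (norm_nonneg _), ← ENNReal.ofReal_mul (by positivity)]
    congr 1
    simp only [norm_div, Complex.norm_natCast]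
    field_simp
  rw [hb, mul_assoc, ← ENNReal.ofReal_mul (by positivity)]
  gcongr
  exact factorial_sq_mul_integral_le hn k hα

theorem mainTheorem4 (n : ℕ) :
    (∀ p : ℝ, (n : ℝ) ≤ p →
      MeasureTheory.IntegrableOn (laguerreIntegrand n p) (Set.Ioi (0 : ℝ))) ∧
    Filter.Tendsto (laguerreA n) Filter.atTop (nhds 1) ∧
    (n = 0 → ∀ p : ℝ, 0 ≤ p → laguerreA n p = 1) ∧
    (1 ≤ n → n ≤ 4 → ∀ p : ℝ, (n : ℝ) ≤ p → laguerreA n p < 1) ∧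
    (n ≤ 4 → ∀ α : ℝ, 0 < α → ∀ f : ℂ → ℂ, MemFock α f →
      MeasureTheory.MemLp (iteratedDeriv n f) 2 (fockMeasureN n α) ∧
      ∫ z, ‖iteratedDeriv n f z‖ ^ 2 ∂(fockMeasureN n α) ≤ ∫ z, ‖f z‖ ^ 2 ∂(fockMeasure α)) := by
  refine ⟨fun p hp => integrableOn_laguerreIntegrand n hp, tendsto_laguerreA n, ?_,
    fun h1 h4 p hp => laguerreA_lt_one h1 h4 hp, ?_⟩
  · rintro rfl p hp
    exact laguerreA_zero hp
  intro hn α hα f ⟨hf, hfL⟩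
  have hle := lintegral_enorm_sq_iteratedDeriv_le hn hα hf
  have hg : Continuous (iteratedDeriv n f) :=
    (hf.contDiff (n := (n : ℕ))).continuous_iteratedDeriv n le_rfl
  have hfi := (memLp_two_iff_integrable_sq_norm hf.continuous.aestronglyMeasurable).1 hfL
  have he : ∀ w : ℂ, ENNReal.ofReal (‖w‖ ^ 2) = ‖w‖ₑ ^ 2 := fun w => by
    rw [ENNReal.ofReal_pow (norm_nonneg _), ofReal_norm]
  have hfin : ∫⁻ z, ‖f z‖ₑ ^ 2 ∂fockMeasure α < ⊤ := by
    simpa only [he] using (hasFiniteIntegral_iff_ofReal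
      (Filter.Eventually.of_forall fun z => sq_nonneg ‖f z‖)).1 hfi.2
  refine ⟨(memLp_two_iff_integrable_sq_norm hg.aestronglyMeasurable).2
    ⟨(hg.norm.pow 2).aestronglyMeasurable, ?_⟩, ?_⟩
  · rw [hasFiniteIntegral_iff_ofReal (Filter.Eventually.of_forall fun z => sq_nonneg _)]
    simpa only [he] using hle.trans_lt hfin
  · rw [integral_eq_lintegral_of_nonneg_ae (Filter.Eventually.of_forall fun z => sq_nonneg _)
        (hg.norm.pow 2).aestronglyMeasurable,
      integral_eq_lintegral_of_nonneg_ae (Filter.Eventually.of_forall fun z => sq_nonneg _)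
        (hf.continuous.norm.pow 2).aestronglyMeasurable]
    simp only [he]
    exact ENNReal.toReal_mono hfin.ne hle
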